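/- Let $q$ be a prime power, let $k\ge 6$ and $m\ge 2$ be even integers, and regard $\mathbb F_{q^m}^k$ as a vector space over $\mathbb F_q$ as well, with coordinates $X_0,\dots,X_{k-1}$. For an $\mathbb F_q$-subspace $U$ of $\mathbb F_{q^m}^k$ let $L_U=\{\langle u\rangle_{\mathbb F_{q^m}} : u\in U\setminus\{0\}\}\subseteq \mathrm{PG}(k-1,q^m)$; its rank is $\dim_{\mathbb F_q}U$, and the weight of a point $\langle v\rangle_{\mathbb F_{q^m}}$ in $L_U$ is $\dim_{\mathbb F_q}(U\cap\langle v\rangle_{\mathbb F_{q^m}})$. The linear set $L_U$ is scattered if all of its points have weight $1$; it is an $i$-club if one of its points has weight $i$ and all of its other points have weight $1$. If $W$ is an $\mathbb F_{q^m}$-subspace of $\mathbb F_{q^m}^k$ and $U\subseteq W$, then $L_U$ is maximum scattered in $\mathrm{PG}(W,\mathbb F_{q^m})$ if it is scattered and $\dim_{\mathbb F_q}U=\frac{m}{2}\dim_{\mathbb F_{q^m}}W$. Let $S$ be an $\mathbb F_q$-subspace of $\mathbb F_{q^m}$ of dimension $i\ge 1$, let $$U_1=\{(x+\zeta,\,x^q,\,x^{q^2},\,0,\dots,0)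 : x\in\mathbb F_{q^m},\ \zeta\in S\}\subseteq\mathbb F_{q^m}^k,$$ let $L_{U_2}$ be a maximum scattered $\mathbb F_q$-linear set in the subspace of $\mathrm{PG}(k-1,q^m)$ with equations $X_0=X_1=X_2=0$, and let $U=U_1+U_2$. Then $L_U$ is an $i$-club in $\mathrm{PG}(k-1,q^m)$ of rank $\frac{m(k-1)}2+i$. Moreover, suppose that $i\le m-3$. Let $V=U'+U''$ be any cone construction with the same $i$, that is: $L_{U'}$ is a maximum scattered $\mathbb F_q$-linear set in a hyperplane $\mathrm{PG}(W,\mathbb F_{q^m})$ of $\mathrm{PG}(k-1,q^m)$, and $U''$ is an $i$-dimensional $\mathbb F_q$-subspace of $\langle x\rangle_{\mathbb F_{q^m}}$ for some nonzero $x\in\mathbb F_{q^m}^k$ with $\langle x\rangle_{\mathbb F_{q^m}}\cap W=\{0\}$. Then $L_U$ and $L_V$ are not $\Gamma\mathrm L(k,q^m)$-equivalent: no invertible $\mathbb F_{q^m}$-semilinear map of $\mathbb F_{q^m}^k$ (with respect to any automorphism of $\mathbb F_{q^m}$) maps the point set $L_U$ onto $L_V$, and none maps the subspace $U$ onto $V$.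 -/

import Mathlib

open scoped LinearAlgebra.Projectivization
open Module

namespace LinearSets

/-- The linear set `L_U = {⟨u⟩_F : u ∈ U, u ≠ 0}` of a `K`-subspace `U` of the `F`-vector space
`V`, as a set of points of `PG(V, F)`. Its rank is `finrank K U`. -/
def linearSet {K : Type*} (F : Type*) {V : Type*} [Field K] [Field F] [AddCommGroup V]
    [Module K V] [Module F V] (U : Submodule K V) : Set (ℙ F V) :=
  {P | ∃ (u : V) (hu : u ≠ 0), u ∈ U ∧ P = Projectivization.mk F u hu}

/-- The weight `dim_K (U ∩ W)` in `L_U` of the projective subspace `PG(W, F)`. -/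
noncomputable def weight {K F V : Type*} [Field K] [Field F] [Algebra K F] [AddCommGroup V]
    [Module K V] [Module F V] [IsScalarTower K F V]
    (U : Submodule K V) (W : Submodule F V) : ℕ :=
  finrank K ↥(U ⊓ W.restrictScalars K)

/-- `L_U` is scattered: all of its points have weight one. -/
def IsScattered {K : Type*} (F : Type*) {V : Type*} [Field K] [Field F] [Algebra K F]
    [AddCommGroup V] [Module K V] [Module F V] [IsScalarTower K F V]
    (U : Submodule K V) : Prop :=
  ∀ P ∈ linearSet F U, weight U P.submodule = 1

/-- `L_U` is an `i`-club: some point of `L_U` has weight `i` and every other point of `L_U` has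
weight one. -/
def IsClub {K : Type*} (F : Type*) {V : Type*} [Field K] [Field F] [Algebra K F]
    [AddCommGroup V] [Module K V] [Module F V] [IsScalarTower K F V]
    (i : ℕ) (U : Submodule K V) : Prop :=
  ∃ P ∈ linearSet F U, weight U P.submodule = i ∧
    ∀ Q ∈ linearSet F U, Q ≠ P → weight U Q.submodule = 1

/-- `L_U` is a maximum scattered linear set in `PG(W, F)`: it is contained in `PG(W, F)`, it is
scattered and its rank is `dim_F W * [F : K] / 2`. -/
def IsMaximumScatteredIn {K F V : Type*} [Field K] [Field F] [Algebra K F]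
    [AddCommGroup V] [Module K V] [Module F V] [IsScalarTower K F V]
    (W : Submodule F V) (U : Submodule K V) : Prop :=
  U ≤ W.restrictScalars K ∧ IsScattered F U ∧ 2 * finrank K U = finrank F W * finrank K F

/-- The cone construction: `U = U' + U''` with `L_{U'}` maximum scattered in a hyperplane
`PG(W, F)`, and `U''` an `i`-dimensional `K`-subspace of `⟨x⟩_F` for a point `⟨x⟩_F` outside
this hyperplane. -/
def IsConeConstruction {K : Type*} (F : Type*) {V : Type*} [Field K] [Field F] [Algebra K F]
    [AddCommGroup V] [Module K V] [Module F V] [IsScalarTower K F V]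
    (i : ℕ) (U : Submodule K V) : Prop :=
  ∃ W : Submodule F V, finrank F W + 1 = finrank F V ∧
    ∃ U' : Submodule K V, IsMaximumScatteredIn W U' ∧
      ∃ x : V, x ≠ 0 ∧ Submodule.span F {x} ⊓ W = ⊥ ∧
        ∃ U'' : Submodule K V, U'' ≤ (Submodule.span F {x}).restrictScalars K ∧
          finrank K U'' = i ∧ U = U' ⊔ U''

/-- `ΓL`-equivalence of `K`-subspaces of `V`: some invertible `F`-semilinear map of `V` (with
respect to any field automorphism of `F`) maps `U` onto `U'`. -/
def SubspaceEquivalent {K : Type*} (F : Type*) {V : Type*} [Field K] [Field F]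
    [AddCommGroup V] [Module K V] [Module F V] (U U' : Submodule K V) : Prop :=
  ∃ (σ : F ≃+* F) (φ : V →ₛₗ[(σ : F →+* F)] V),
    Function.Bijective φ ∧ φ '' (U : Set V) = (U' : Set V)

/-- `ΓL`-equivalence of sets of points of `PG(V, F)`: the collineation induced by some invertible
`F`-semilinear map of `V` maps `A` onto `B`. -/
def PointSetEquivalent {F V : Type*} [Field F] [AddCommGroup V] [Module F V]
    (A B : Set (ℙ F V)) : Prop :=
  ∃ (σ : F ≃+* F) (φ : V →ₛₗ[(σ : F →+* F)] V) (hφ : Function.Bijective φ),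
    Projectivization.map φ hφ.injective '' A = B

/-- The vector `(a, b, c, 0, …, 0)` of `F ^ k`. -/
def vec3 {F : Type*} [Zero F] (k : ℕ) (a b c : F) : Fin k → F := fun j =>
  if (j : ℕ) = 0 then a else if (j : ℕ) = 1 then b else if (j : ℕ) = 2 then c else 0

/-- The `K`-subspace `U₁ = {(x + ζ, x ^ q, x ^ (q ^ 2), 0, …, 0) : x ∈ F, ζ ∈ S}` of `F ^ k`,
where `q = |K|`. -/
def liftedSpace {K F : Type*} [Field K] [Fintype K] [Field F] [Algebra K F]
    (k : ℕ) (S : Submodule K F) : Submodule K (Fin k → F) where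
  carrier := {v | ∃ x : F, ∃ ζ ∈ S,
    v = vec3 k (x + ζ) (x ^ Fintype.card K) (x ^ (Fintype.card K) ^ 2)}
  zero_mem' := by
    refine ⟨0, 0, S.zero_mem, ?_⟩
    have h : Fintype.card K ≠ 0 := Fintype.card_ne_zero
    funext j
    simp [vec3, h]
  add_mem' := by
    rintro _ _ ⟨x, ζ, hζ, rfl⟩ ⟨y, η, hη, rfl⟩
    refine ⟨x + y, ζ + η, S.add_mem hζ hη, ?_⟩
    have h (a b : F) :
        (a + b) ^ Fintype.card K = a ^ Fintype.card K + b ^ Fintype.card K := by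
      simpa using map_add (FiniteField.frobeniusAlgHom K F) a b
    funext j
    simp only [vec3, Pi.add_apply, pow_two, pow_mul, h]
    split_ifs <;> ring
  smul_mem' := by
    rintro c _ ⟨x, ζ, hζ, rfl⟩
    refine ⟨c • x, c • ζ, S.smul_mem c hζ, ?_⟩
    have h (a : F) : (c • a) ^ Fintype.card K = c • a ^ Fintype.card K := by
      rw [Algebra.smul_def, mul_pow, ← map_pow, FiniteField.pow_card, ← Algebra.smul_def]
    funext j
    simp only [vec3, Pi.smul_apply, pow_two, pow_mul, h]
    split_ifs <;> simp

/-- The `F`-subspace of `F ^ k` with equations `X₀ = X₁ = X₂ = 0`. -/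
def firstThreeZero (F : Type*) [Field F] (k : ℕ) : Submodule F (Fin k → F) where
  carrier := {v | ∀ j : Fin k, (j : ℕ) < 3 → v j = 0}
  zero_mem' := fun _ _ => rfl
  add_mem' := fun ha hb j hj => by simp [ha j hj, hb j hj]
  smul_mem' := fun c a ha j hj => by simp [ha j hj]

end LinearSets

/-! Let `P = ⟨(1, 0, …, 0)⟩`, `m = [F : K]` and `q = |K|`. If `l` maps a vector of `U` with
parameter `x ≠ 0` back into `U`, with new parameter `y`, then `l x^q = y^q` and `l x^(q²) = y^(q²)`,
so `l^q = l` and `l ∈ K`. If `x = 0`, either the `U₂`-component is nonzero and scatteredness of `U₂`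
gives `l ∈ K`, or the point is `P`, whose weight is `dim S = i` (`weight_firstPoint`,
`weight_eq_one_of_ne_firstPoint`).

For the inequivalence, a cone meets its base hyperplane in a scattered set of rank `n = m(k-1)/2`,
so an equivalence gives a hyperplane `ker g` with `(q^n - 1)/(q - 1)` points of `L_U`. Counting
vectors point by point yields `dim (U ∩ ker g) = n`, and `P ∉ ker g` unless `i = 1`
(`finrank_inf_eq_of_ncard_eq`). Hence `dim g(U) = i ≤ m - 3`. On the vectors `(x, x^q, x^(q²), 0, …,
0)` the functional `g` is a `q`-polynomial of `q`-degree at most 2 with kernel of dimension at least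
3, hence zero (`apply_vec3_eq_zero`). So `P ∈ ker g` and `i = 1`. Now `g` is nonzero on `X₀ = X₁ =
X₂ = 0`, and the rank bound for scattered sets forces `dim g(U₂) ≥ m/2 ≥ 2`, although `dim g(U) =
1`. -/

namespace LinearSets

/-! ### Weights, the scattered rank bound and point counts -/

section General

variable {K F V : Type*} [Field K] [Field F] [Algebra K F] [AddCommGroup V]
  [Module K V] [Module F V] [IsScalarTower K F V]

/-- A point of `L_U` has weight one iff the scalars preserving a representative's membership in
`U` are exactly those of `K`. -/
theorem weight_mk_eq_one_iff {U : Submodule K V} {u : V} (hu : u ≠ 0) (huU : u ∈ U) :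
    weight U (Projectivization.mk F u hu).submodule = 1 ↔
      ∀ l : F, l • u ∈ U → ∃ c : K, algebraMap K F c = l := by
  have hmem : u ∈ U ⊓ ((Projectivization.mk F u hu).submodule).restrictScalars K :=
    ⟨huU, by simp⟩
  unfold weight
  rw [finrank_eq_one_iff_of_nonzero' (⟨u, hmem⟩ : ↥(U ⊓ _))
    (fun h => hu (congrArg Subtype.val h))]
  constructor
  · intro h l hl
    obtain ⟨c, hc⟩ := h ⟨l • u, hl, by
      simpa using Submodule.smul_mem _ l (Submodule.mem_span_singleton_self u)⟩
    have hc' : c • u = l • u := congrArg Subtype.val hc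
    refine ⟨c, ?_⟩
    rw [← algebraMap_smul F c u] at hc'
    exact smul_left_injective F hu hc'
  · rintro h ⟨w, hwU, hw⟩
    obtain ⟨l, rfl⟩ := Submodule.mem_span_singleton.1 (by simpa using hw)
    obtain ⟨c, rfl⟩ := h l hwU
    exact ⟨c, Subtype.ext (algebraMap_smul F c u).symm⟩

theorem isScattered_iff {U : Submodule K V} :
    IsScattered F U ↔
      ∀ u ∈ U, u ≠ 0 → ∀ l : F, l • u ∈ U → ∃ c : K, algebraMap K F c = l := by
  constructor
  · intro h u huU hu
    exact (weight_mk_eq_one_iff hu huU).1 (h _ ⟨u, hu, huU, rfl⟩)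
  · rintro h _ ⟨u, hu, huU, rfl⟩
    exact (weight_mk_eq_one_iff hu huU).2 (h u huU hu)

theorem IsScattered.mono {U U' : Submodule K V} (h : IsScattered F U) (hle : U' ≤ U) :
    IsScattered F U' :=
  isScattered_iff.2 fun u hu hu0 l hl => isScattered_iff.1 h u (hle hu) hu0 l (hle hl)

/-- Restricting `U` to a projective subspace `PG(W, F)` does not change the weights of the points
of that subspace. -/
theorem weight_inf_of_le {U : Submodule K V} {W X : Submodule F V} (h : X ≤ W) :
    weight (U ⊓ W.restrictScalars K) X = weight U X := by
  have : U ⊓ W.restrictScalars K ⊓ X.restrictScalars K = U ⊓ X.restrictScalars K := by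
    ext v
    simp only [Submodule.mem_inf, Submodule.restrictScalars_mem]
    exact ⟨fun hv => ⟨hv.1.1, hv.2⟩, fun hv => ⟨⟨hv.1, h hv.2⟩, hv.2⟩⟩
  unfold weight
  rw [this]

theorem mem_linearSet_inf {U : Submodule K V} {W : Submodule F V} {P : ℙ F V} :
    P ∈ linearSet F (U ⊓ W.restrictScalars K) ↔ P ∈ linearSet F U ∧ P.submodule ≤ W := by
  constructor
  · rintro ⟨u, hu, huU, rfl⟩
    refine ⟨⟨u, hu, huU.1, rfl⟩, ?_⟩
    simpa [Submodule.span_singleton_le_iff_mem] using huU.2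
  · rintro ⟨⟨u, hu, huU, rfl⟩, h⟩
    refine ⟨u, hu, ⟨huU, ?_⟩, rfl⟩
    simpa [Submodule.span_singleton_le_iff_mem] using h

/-- A scattered linear set in `PG(W, F)` has rank at most `dim W * [F : K] / 2`. -/
theorem IsScattered.two_mul_finrank_le [FiniteDimensional K F] [FiniteDimensional F V]
    (hF : 1 < finrank K F) {U : Submodule K V} (hU : IsScattered F U) {W : Submodule F V}
    (hUW : U ≤ W.restrictScalars K) :
    2 * finrank K U ≤ finrank F W * finrank K F := by
  have : FiniteDimensional K V := FiniteDimensional.trans K F V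
  -- For `l ∉ K`, scatteredness makes `U` and `l U` meet trivially; both lie in `W`, so twice the
  -- rank fits into `dim_K W`.
  obtain ⟨l, hl⟩ : ∃ l : F, ∀ c : K, algebraMap K F c ≠ l := by
    by_contra! h
    have h1 : Function.Surjective (algebraMap K F) := h
    have h2 : Function.Surjective (Algebra.linearMap K F) := h1
    have := LinearMap.finrank_le_finrank_of_surjective h2
    simp at this
    omega
  have hl0 : l ≠ 0 := fun h => hl 0 (by simp [h])
  let f : V →ₗ[K] V := (LinearMap.lsmul F V l).restrictScalars K
  have hf : Function.Injective f := by
    intro a b hab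
    exact smul_right_injective V hl0 hab
  have hdisj : U ⊓ U.map f = ⊥ := by
    rw [eq_bot_iff]
    rintro _ ⟨hv, u, hu, rfl⟩
    by_contra hne
    have hu0 : u ≠ 0 := by
      rintro rfl
      exact hne (by simp)
    obtain ⟨c, hc⟩ := isScattered_iff.1 hU u hu hu0 l hv
    exact hl c hc
  have hsum := Submodule.finrank_sup_add_finrank_inf_eq U (U.map f)
  have hmap : finrank K (U.map f) = finrank K U :=
    LinearEquiv.finrank_eq (Submodule.equivMapOfInjective f hf U).symm
  have hle : U ⊔ U.map f ≤ W.restrictScalars K := by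
    refine sup_le hUW ?_
    rintro _ ⟨u, hu, rfl⟩
    exact W.smul_mem l (hUW hu)
  have hfin := Submodule.finrank_mono hle
  have hW : finrank K (W.restrictScalars K) = finrank F W * finrank K F := by
    rw [mul_comm]
    exact (finrank_mul_finrank K F W).symm
  rw [hdisj, hmap, finrank_bot] at hsum
  omega

open scoped Classical in
/-- Counting the nonzero vectors of `U` point by point. -/
theorem card_pow_finrank_eq [Fintype K] [Finite V] (U : Submodule K V) :
    Fintype.card K ^ finrank K U =
      1 + ∑ P ∈ (Set.toFinite (linearSet F U)).toFinset,
        (Fintype.card K ^ weight U P.submodule - 1) := by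
  have : Fintype V := Fintype.ofFinite V
  have key (T : Submodule K V) :
      (Finset.univ.filter fun v : V => v ∈ T ∧ v ≠ 0).card + 1 = Fintype.card K ^ finrank K T := by
    rw [← Module.card_eq_pow_finrank (K := K) (V := T), Fintype.card_subtype,
      ← Finset.card_erase_add_one (s := Finset.univ.filter fun v : V => v ∈ T) (a := (0 : V))
        (by simp [T.zero_mem])]
    congr 2
    ext v
    simp [and_comm]
  let s : Finset {v : V // v ∈ U ∧ v ≠ 0} := Finset.univ
  let f : {v : V // v ∈ U ∧ v ≠ 0} → ℙ F V := fun v => Projectivization.mk F v.1 v.2.2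
  have hs : s.card + 1 = Fintype.card K ^ finrank K U := by
    rw [← key U, Finset.card_univ, Fintype.card_subtype]
  have hfib := Finset.card_eq_sum_card_fiberwise (f := f) (s := s)
    (t := (Set.toFinite (linearSet F U)).toFinset) (by
      intro v _
      simpa using ⟨v.1, v.2.2, v.2.1, rfl⟩)
  rw [← hs, hfib, add_comm]
  congr 1
  refine Finset.sum_congr rfl fun P _ => ?_
  rw [weight, ← key, Nat.add_sub_cancel]
  refine Finset.card_bij (fun v _ => v.1) ?_ (fun _ _ _ _ h => Subtype.ext h) ?_
  · rintro ⟨v, hv, hv0⟩ h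
    have h' : Projectivization.mk F v hv0 = P := by simpa [s, f] using h
    subst h'
    simp [hv0, hv]
  · intro v hv
    induction P with | h u hu =>
    simp only [Finset.mem_filter, Finset.mem_univ, true_and, Submodule.mem_inf,
      Submodule.restrictScalars_mem, Projectivization.submodule_mk] at hv
    refine ⟨⟨v, hv.1.1, hv.2⟩, ?_, rfl⟩
    simp only [s, f, Finset.mem_filter, Finset.mem_univ, true_and]
    rw [Projectivization.mk_eq_mk_iff']
    exact Submodule.mem_span_singleton.1 hv.1.2

theorem IsScattered.card_pow_finrank_eq [Fintype K] [Finite V] {U : Submodule K V}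
    (hU : IsScattered F U) :
    Fintype.card K ^ finrank K U = 1 + (linearSet F U).ncard * (Fintype.card K - 1) := by
  classical
  rw [LinearSets.card_pow_finrank_eq (F := F) U, Finset.sum_congr rfl (g := fun _ =>
    Fintype.card K - 1), Finset.sum_const, smul_eq_mul,
    Set.ncard_eq_toFinset_card _ (Set.toFinite (linearSet F U))]
  intro P hP
  rw [hU P (by simpa using hP), pow_one]

/-- The size of a linear set all of whose points but one have weight one. -/
theorem card_pow_finrank_eq_of_weight [Fintype K] [Finite V] {U : Submodule K V} {P : ℙ F V}
    (hP : P ∈ linearSet F U) (h : ∀ Q ∈ linearSet F U, Q ≠ P → weight U Q.submodule = 1) :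
    Fintype.card K ^ finrank K U + Fintype.card K =
      1 + (linearSet F U).ncard * (Fintype.card K - 1) +
        Fintype.card K ^ weight U P.submodule := by
  classical
  have hP' : P ∈ (Set.toFinite (linearSet F U)).toFinset := by simpa using hP
  rw [LinearSets.card_pow_finrank_eq (F := F) U, ← Finset.add_sum_erase _ _ hP',
    Finset.sum_congr rfl (g := fun _ => Fintype.card K - 1), Finset.sum_const, smul_eq_mul,
    Set.ncard_eq_toFinset_card _ (Set.toFinite (linearSet F U)),
    ← Finset.card_erase_add_one hP', add_mul]
  · have h1 : 0 < Fintype.card K := Fintype.card_pos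
    have h2 : 0 < Fintype.card K ^ weight U P.submodule := pow_pos h1 _
    omega
  · intro Q hQ
    have hQ' := Finset.mem_erase.1 hQ
    rw [h Q (by simpa using hQ'.2) hQ'.1, pow_one]

end General

/-! ### Pulling back the base hyperplane of a cone -/

section Cone

variable {K F V : Type*} [Field K] [Field F] [Algebra K F] [AddCommGroup V]
  [Module K V] [Module F V] [IsScalarTower K F V]

/-- If `L_U` is equivalent to the linear set of a cone construction, then some hyperplane meets
`L_U` in as many points as a maximum scattered linear set of a hyperplane has. -/
theorem IsConeConstruction.exists_hyperplane_of_pointSetEquivalent [Fintype K] [Finite V]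
    [FiniteDimensional F V] {i : ℕ} {U C : Submodule K V} (hC : IsConeConstruction F i C)
    (h : PointSetEquivalent (linearSet F U) (linearSet F C)) :
    ∃ (g : V →ₗ[F] F) (n : ℕ), g ≠ 0 ∧ 2 * n + finrank K F = finrank F V * finrank K F ∧
      Fintype.card K ^ n =
        1 + (linearSet F (U ⊓ (LinearMap.ker g).restrictScalars K)).ncard *
          (Fintype.card K - 1) := by
  obtain ⟨W, hW, U', ⟨hU'W, hU', hrank⟩, x, hx, hxW, U'', hU'', -, rfl⟩ := hC
  obtain ⟨σ, φ, hφ, himg⟩ := h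
  have hWlt : W < ⊤ := by
    rw [lt_top_iff_ne_top]
    rintro rfl
    rw [finrank_top] at hW
    omega
  obtain ⟨f, hf0, hWf⟩ := Submodule.exists_le_ker_of_lt_top W hWlt
  have hWker : W = LinearMap.ker f := by
    refine Submodule.eq_of_le_of_finrank_eq hWf ?_
    have := Module.Dual.finrank_ker_add_one_of_ne_zero (f := f) hf0
    omega
  -- Composing with `σ⁻¹` turns the `σ`-semilinear `f ∘ φ` into an `F`-linear functional with the
  -- same zeros.
  let g : V →ₗ[F] F :=
    { toFun := fun v => σ.symm (f (φ v))
      map_add' := by simp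
      map_smul' := by simp }
  have hg (v : V) : g v = 0 ↔ φ v ∈ W := by
    rw [hWker]
    simp [g]
  -- Modular law: the vertex part `U''` meets the hyperplane only in zero.
  have hinf : (U' ⊔ U'') ⊓ W.restrictScalars K = U' := by
    rw [sup_inf_assoc_of_le _ hU'W, sup_eq_left]
    rintro v ⟨hv, hvW⟩
    have : v ∈ Submodule.span F {x} ⊓ W := ⟨hU'' hv, hvW⟩
    rw [hxW, Submodule.mem_bot] at this
    simp [this]
  refine ⟨g, finrank K U', ?_, ?_, ?_⟩
  · intro h0
    apply hf0
    ext w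
    obtain ⟨v, rfl⟩ := hφ.2 w
    have : g v = 0 := by simp [h0]
    rw [hg, hWker] at this
    simpa using this
  · rw [hrank, ← hW, add_mul, one_mul]
  · rw [hU'.card_pow_finrank_eq]
    have himg' : Projectivization.map φ hφ.injective ''
        linearSet F (U ⊓ (LinearMap.ker g).restrictScalars K) = linearSet F U' := by
      rw [← hinf]
      ext P
      rw [mem_linearSet_inf, ← himg]
      constructor
      · rintro ⟨Q, hQ, rfl⟩
        rw [mem_linearSet_inf] at hQ
        refine ⟨⟨Q, hQ.1, rfl⟩, ?_⟩
        induction Q with | h u hu =>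
        have h2 := hQ.2
        simp only [Projectivization.submodule_mk, Submodule.span_singleton_le_iff_mem,
          LinearMap.mem_ker, hg] at h2
        simpa [Projectivization.map_mk, Submodule.span_singleton_le_iff_mem] using h2
      · rintro ⟨⟨Q, hQ, rfl⟩, h2⟩
        refine ⟨Q, mem_linearSet_inf.2 ⟨hQ, ?_⟩, rfl⟩
        induction Q with | h u hu =>
        simp only [Projectivization.map_mk, Projectivization.submodule_mk,
          Submodule.span_singleton_le_iff_mem] at h2
        simpa [Submodule.span_singleton_le_iff_mem, hg] using h2
    have := RingHomInvPair.of_ringEquiv σ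
    rw [← himg', Set.ncard_image_of_injective _
      (Projectivization.map_injective φ hφ.injective (τ := (σ.symm : F →+* F)))]

end Cone

theorem SubspaceEquivalent.pointSetEquivalent {K F V : Type*} [Field K] [Field F]
    [AddCommGroup V] [Module K V] [Module F V] {U U' : Submodule K V}
    (h : SubspaceEquivalent F U U') :
    PointSetEquivalent (linearSet F U) (linearSet F U') := by
  obtain ⟨σ, φ, hφ, himg⟩ := h
  refine ⟨σ, φ, hφ, ?_⟩
  ext P
  constructor
  · rintro ⟨_, ⟨u, hu, huU, rfl⟩, rfl⟩
    exact ⟨φ u, fun h0 => hu (hφ.1 (h0.trans (map_zero φ).symm)), himg.subset ⟨u, huU, rfl⟩, rfl⟩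
  · rintro ⟨w, hw, hwU, rfl⟩
    have hw' : w ∈ φ '' (U : Set V) := himg ▸ hwU
    obtain ⟨u, huU, rfl⟩ := hw'
    have hu : u ≠ 0 := by
      rintro rfl
      exact hw (map_zero φ)
    exact ⟨_, ⟨u, hu, huU, rfl⟩, rfl⟩

/-! ### Roots of `q`-polynomials -/

section Field

variable {K F : Type*} [Field K] [Fintype K] [Field F] [Algebra K F]

/-- Otherwise `X^q - X` would have `q + 1` roots: the elements of `K` and `l`. -/
theorem exists_algebraMap_eq_of_pow_card_eq {l : F} (hl : l ^ Fintype.card K = l) :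
    ∃ c : K, algebraMap K F c = l := by
  classical
  by_contra! h
  have hq : 1 < Fintype.card K := Fintype.one_lt_card
  refine FiniteField.X_pow_card_sub_X_ne_zero F hq
    (Polynomial.eq_zero_of_natDegree_lt_card_of_eval_eq_zero' _
      (insert l (Finset.univ.image (algebraMap K F))) ?_ ?_)
  · intro y hy
    rcases Finset.mem_insert.1 hy with rfl | hy
    · simp [hl]
    · obtain ⟨c, -, rfl⟩ := Finset.mem_image.1 hy
      simp [← map_pow, FiniteField.pow_card]
  · rw [FiniteField.X_pow_card_sub_X_natDegree_eq F hq, Finset.card_insert_of_notMem,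
      Finset.card_image_of_injective _ (algebraMap K F).injective, Finset.card_univ]
    · exact Nat.lt_succ_self _
    · simpa using h

open Polynomial in
/-- A `q`-polynomial of `q`-degree at most two whose kernel has dimension at least three
vanishes. -/
theorem eq_zero_of_three_le_finrank_ker [Finite F] {a b c : F} {h : F →ₗ[K] F}
    (hh : ∀ x, h x = a * x + b * x ^ Fintype.card K + c * x ^ Fintype.card K ^ 2)
    (hker : 3 ≤ finrank K (LinearMap.ker h)) : a = 0 ∧ b = 0 ∧ c = 0 := by
  classical
  have : Fintype F := Fintype.ofFinite F
  set q := Fintype.card K with hqdef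
  have hq : 1 < q := Fintype.one_lt_card
  have hq2 : q < q ^ 2 := by nlinarith
  let p : F[X] := C a * X ^ 1 + C b * X ^ q + C c * X ^ q ^ 2
  have hp : p = 0 := by
    -- The degree is at most `q²`, while the kernel supplies at least `q³` roots.
    refine eq_zero_of_natDegree_lt_card_of_eval_eq_zero p
      (f := fun x : LinearMap.ker h => (x : F)) Subtype.val_injective ?_ ?_
    · rintro ⟨x, hx⟩
      rw [LinearMap.mem_ker, hh] at hx
      simpa [p] using hx
    · rw [Module.card_eq_pow_finrank (K := K)]
      have hdeg : p.natDegree ≤ q ^ 2 := by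
        refine natDegree_add_le_of_degree_le (natDegree_add_le_of_degree_le ?_ ?_) ?_
        · exact (natDegree_C_mul_X_pow_le _ _).trans (by omega)
        · exact (natDegree_C_mul_X_pow_le _ _).trans hq2.le
        · exact natDegree_C_mul_X_pow_le _ _
      exact hdeg.trans_lt (Nat.pow_lt_pow_right hq (by omega))
  have hc (n : ℕ) : p.coeff n = 0 := by simp [hp]
  have h1 := hc 1
  have h2 := hc q
  have h3 := hc (q ^ 2)
  simp only [p, coeff_add, coeff_C_mul, coeff_X_pow] at h1 h2 h3
  refine ⟨?_, ?_, ?_⟩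
  · simpa [show 1 ≠ q by omega, show 1 ≠ q ^ 2 by omega] using h1
  · simpa [show q ≠ 1 by omega, show q ≠ q ^ 2 by omega] using h2
  · simpa [show q ^ 2 ≠ 1 by omega, show q ^ 2 ≠ q by omega, show q ≠ 1 by omega] using h3

end Field

/-! ### Splitting off the first three coordinates -/

section Vec3

variable {F : Type*} [Field F] {k : ℕ}

theorem smul_vec3 (l a b c : F) : l • vec3 k a b c = vec3 k (l * a) (l * b) (l * c) := by
  funext j
  simp only [vec3, Pi.smul_apply, smul_eq_mul]
  split_ifs <;> simp

theorem vec3_add_vec3 (a b c a' b' c' : F) :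
    vec3 k a b c + vec3 k a' b' c' = vec3 k (a + a') (b + b') (c + c') := by
  funext j
  simp only [vec3, Pi.add_apply]
  split_ifs <;> simp

@[simp]
theorem vec3_zero : vec3 k (0 : F) 0 0 = 0 := by
  funext j
  simp [vec3]

theorem vec3_add_eq_vec3_add_iff (hk : 3 ≤ k) {a b c a' b' c' : F} {w w' : Fin k → F}
    (hw : w ∈ firstThreeZero F k) (hw' : w' ∈ firstThreeZero F k) :
    vec3 k a b c + w = vec3 k a' b' c' + w' ↔ a = a' ∧ b = b' ∧ c = c' ∧ w = w' := by
  constructor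
  · intro h
    have hj (j : Fin k) (hj3 : (j : ℕ) < 3) : vec3 k a b c j = vec3 k a' b' c' j := by
      simpa [hw j hj3, hw' j hj3] using congrFun h j
    have ha : a = a' := by simpa [vec3] using hj ⟨0, by omega⟩ (by simp)
    have hb : b = b' := by simpa [vec3] using hj ⟨1, by omega⟩ (by simp)
    have hc : c = c' := by simpa [vec3] using hj ⟨2, by omega⟩ (by simp)
    subst ha hb hc
    exact ⟨rfl, rfl, rfl, add_left_cancel h⟩
  · rintro ⟨rfl, rfl, rfl, rfl⟩
    rfl

theorem vec3_eq_vec3_iff (hk : 3 ≤ k) {a b c a' b' c' : F} :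
    vec3 k a b c = vec3 k a' b' c' ↔ a = a' ∧ b = b' ∧ c = c' := by
  simpa using vec3_add_eq_vec3_add_iff (a := a) (b := b) (c := c) (a' := a') (b' := b') (c' := c')
    hk (zero_mem (firstThreeZero F k)) (zero_mem (firstThreeZero F k))

theorem exists_eq_vec3_add (hk : 3 ≤ k) (v : Fin k → F) :
    ∃ a b c : F, ∃ w ∈ firstThreeZero F k, v = vec3 k a b c + w := by
  refine ⟨v ⟨0, by omega⟩, v ⟨1, by omega⟩, v ⟨2, by omega⟩,
    v - vec3 k (v ⟨0, by omega⟩) (v ⟨1, by omega⟩) (v ⟨2, by omega⟩), ?_, by simp⟩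
  rintro ⟨j, hjk⟩ hj
  have hj' : j < 3 := hj
  interval_cases j <;> simp [vec3]

theorem finrank_firstThreeZero (hk : 3 ≤ k) : finrank F (firstThreeZero F k) + 3 = k := by
  let π : (Fin k → F) →ₗ[F] (Fin 3 → F) := LinearMap.funLeft F F (Fin.castLE hk)
  have hker : LinearMap.ker π = firstThreeZero F k := by
    ext v
    rw [LinearMap.mem_ker]
    constructor
    · intro h j hj
      simpa [π, LinearMap.funLeft_apply] using congrFun h ⟨j, hj⟩
    · intro h
      funext j
      exact h (Fin.castLE hk j) (by simp)
  have hsurj : Function.Surjective π :=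
    LinearMap.funLeft_surjective_of_injective F F _ (Fin.castLE_injective hk)
  have := LinearMap.finrank_range_add_finrank_ker π
  rw [LinearMap.range_eq_top.2 hsurj, hker, finrank_top] at this
  simp at this
  omega

end Vec3

/-! ### The lifted space, its heavy point and functionals on it -/

section Lifted

variable {K F : Type*} [Field K] [Fintype K] [Field F] [Algebra K F] {k : ℕ}

/-- The parametrization `(x, ζ) ↦ (x + ζ, x ^ q, x ^ (q ^ 2), 0, …, 0)` of `liftedSpace`. -/
def liftedMap (k : ℕ) (S : Submodule K F) : F × S →ₗ[K] (Fin k → F) where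
  toFun p := vec3 k (p.1 + p.2) (p.1 ^ Fintype.card K) (p.1 ^ (Fintype.card K) ^ 2)
  map_add' := by
    rintro ⟨x, ζ⟩ ⟨y, η⟩
    have h (a b : F) :
        (a + b) ^ Fintype.card K = a ^ Fintype.card K + b ^ Fintype.card K := by
      simpa using map_add (FiniteField.frobeniusAlgHom K F) a b
    rw [vec3_add_vec3]
    simp only [Prod.mk_add_mk, Submodule.coe_add, pow_two, pow_mul, h]
    rw [add_add_add_comm]
  map_smul' := by
    rintro c ⟨x, ζ⟩
    have h (a : F) : (c • a) ^ Fintype.card K = c • a ^ Fintype.card K := by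
      rw [Algebra.smul_def, mul_pow, ← map_pow, FiniteField.pow_card, ← Algebra.smul_def]
    rw [RingHom.id_apply, ← algebraMap_smul F c (vec3 _ _ _ _), smul_vec3]
    simp only [Prod.smul_mk, Submodule.coe_smul, pow_two, pow_mul, h, ← smul_add]
    simp only [Algebra.smul_def]

theorem range_liftedMap (S : Submodule K F) :
    LinearMap.range (liftedMap k S) = liftedSpace k S := by
  ext v
  constructor
  · rintro ⟨⟨x, ζ⟩, rfl⟩
    exact ⟨x, ζ, ζ.2, rfl⟩
  · rintro ⟨x, ζ, hζ, rfl⟩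
    exact ⟨⟨x, ζ, hζ⟩, rfl⟩

theorem finrank_liftedSpace [Finite F] (hk : 3 ≤ k) (S : Submodule K F) :
    finrank K (liftedSpace k S) = finrank K F + finrank K S := by
  have hinj : Function.Injective (liftedMap k S) := by
    rintro ⟨x, ζ⟩ ⟨y, η⟩ h
    obtain ⟨h1, h2, -⟩ := (vec3_eq_vec3_iff hk).1 h
    have hxy : x = y := (FiniteField.frobeniusAlgHom K F).injective (by simpa using h2)
    subst hxy
    have : ζ = η := Subtype.ext (add_left_cancel h1)
    rw [this]
  rw [← range_liftedMap, LinearMap.finrank_range_of_inj hinj, finrank_prod]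

theorem mem_liftedSpace_sup_iff {S : Submodule K F} {U₂ : Submodule K (Fin k → F)}
    {v : Fin k → F} :
    v ∈ liftedSpace k S ⊔ U₂ ↔ ∃ x : F, ∃ ζ ∈ S, ∃ w ∈ U₂,
      v = vec3 k (x + ζ) (x ^ Fintype.card K) (x ^ (Fintype.card K) ^ 2) + w := by
  rw [Submodule.mem_sup]
  constructor
  · rintro ⟨_, ⟨x, ζ, hζ, rfl⟩, w, hw, rfl⟩
    exact ⟨x, ζ, hζ, w, hw, rfl⟩
  · rintro ⟨x, ζ, hζ, w, hw, rfl⟩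
    exact ⟨_, ⟨x, ζ, hζ, rfl⟩, w, hw, rfl⟩

theorem finrank_liftedSpace_sup [Finite F] (hk : 3 ≤ k) (S : Submodule K F)
    {U₂ : Submodule K (Fin k → F)} (hU₂ : U₂ ≤ (firstThreeZero F k).restrictScalars K) :
    finrank K ↥(liftedSpace k S ⊔ U₂) = finrank K F + finrank K S + finrank K U₂ := by
  have hdisj : liftedSpace k S ⊓ U₂ = ⊥ := by
    rw [eq_bot_iff]
    rintro _ ⟨⟨x, ζ, hζ, rfl⟩, hv⟩
    have h0 : vec3 k (x + ζ) (x ^ Fintype.card K) (x ^ (Fintype.card K) ^ 2) + 0 =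
        vec3 k 0 0 0 +
          vec3 k (x + ζ) (x ^ Fintype.card K) (x ^ (Fintype.card K) ^ 2) := by simp
    have := ((vec3_add_eq_vec3_add_iff hk (zero_mem _) (hU₂ hv)).1 h0).2.2.2
    simp [← this]
  have := Submodule.finrank_sup_add_finrank_inf_eq (liftedSpace k S) U₂
  rw [hdisj, finrank_bot, finrank_liftedSpace hk] at this
  omega

theorem vec3_one_ne_zero (hk : 3 ≤ k) : vec3 k (1 : F) 0 0 ≠ 0 := by
  rw [← vec3_zero, Ne, vec3_eq_vec3_iff hk]
  simp

/-- The point `⟨(1, 0, …, 0)⟩`. -/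
def firstPoint (F : Type*) [Field F] {k : ℕ} (hk : 3 ≤ k) : ℙ F (Fin k → F) :=
  Projectivization.mk F (vec3 k 1 0 0) (vec3_one_ne_zero hk)

theorem vec3_mem_liftedSpace {S : Submodule K F} {ζ : F} (hζ : ζ ∈ S) :
    vec3 k ζ 0 0 ∈ liftedSpace k S :=
  ⟨0, ζ, hζ, by simp [Fintype.card_ne_zero]⟩

theorem firstPoint_mem_linearSet (hk : 3 ≤ k) {S : Submodule K F} (hS : 1 ≤ finrank K S)
    (U₂ : Submodule K (Fin k → F)) :
    firstPoint F hk ∈ linearSet F (liftedSpace k S ⊔ U₂) := by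
  have hne : S ≠ ⊥ := by
    rintro rfl
    simp at hS
  obtain ⟨ζ, hζ, hζ0⟩ := Submodule.exists_mem_ne_zero_of_ne_bot hne
  refine ⟨vec3 k ζ 0 0, ?_, Submodule.mem_sup_left (vec3_mem_liftedSpace hζ), ?_⟩
  · rw [← vec3_zero, Ne, vec3_eq_vec3_iff hk]
    simpa using hζ0
  · rw [firstPoint, Projectivization.mk_eq_mk_iff']
    exact ⟨ζ⁻¹, by simp [smul_vec3, hζ0]⟩

theorem weight_firstPoint (hk : 3 ≤ k) (S : Submodule K F)
    {U₂ : Submodule K (Fin k → F)} (hU₂ : U₂ ≤ (firstThreeZero F k).restrictScalars K) :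
    weight (liftedSpace k S ⊔ U₂) (firstPoint F hk).submodule = finrank K S := by
  let f : F →ₗ[K] (Fin k → F) :=
    (LinearMap.toSpanSingleton F (Fin k → F) (vec3 k 1 0 0)).restrictScalars K
  have hf (a : F) : f a = vec3 k a 0 0 := by simp [f, smul_vec3]
  have hfinj : Function.Injective f := by
    intro a b hab
    rw [hf, hf, vec3_eq_vec3_iff hk] at hab
    exact hab.1
  have hmap : (liftedSpace k S ⊔ U₂) ⊓ ((firstPoint F hk).submodule).restrictScalars K =
      S.map f := by
    ext v
    constructor
    · rintro ⟨hv, hvP⟩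
      obtain ⟨l, rfl⟩ := Submodule.mem_span_singleton.1 (show v ∈ Submodule.span F {vec3 k 1 0 0}
        from hvP)
      obtain ⟨x, ζ, hζ, w, hw, h⟩ := mem_liftedSpace_sup_iff.1 hv
      rw [smul_vec3, ← add_zero (vec3 k (l * 1) _ _),
        vec3_add_eq_vec3_add_iff hk (zero_mem _) (hU₂ hw)] at h
      obtain ⟨h1, h2, -⟩ := h
      have hx : x = 0 := by
        rw [mul_zero, eq_comm] at h2
        exact eq_zero_of_pow_eq_zero h2
      refine ⟨ζ, hζ, ?_⟩
      rw [hf, smul_vec3, h1, hx]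
      simp
    · rintro ⟨ζ, hζ, rfl⟩
      refine ⟨?_, ?_⟩
      · rw [hf]
        exact Submodule.mem_sup_left (vec3_mem_liftedSpace hζ)
      · exact Submodule.mem_span_singleton.2 ⟨ζ, rfl⟩
  rw [weight, hmap]
  exact LinearEquiv.finrank_eq (Submodule.equivMapOfInjective f hfinj S).symm

theorem weight_eq_one_of_ne_firstPoint (hk : 3 ≤ k) {S : Submodule K F}
    {U₂ : Submodule K (Fin k → F)} (hU₂ : U₂ ≤ (firstThreeZero F k).restrictScalars K)
    (hsc : IsScattered F U₂) {Q : ℙ F (Fin k → F)}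
    (hQ : Q ∈ linearSet F (liftedSpace k S ⊔ U₂)) (hne : Q ≠ firstPoint F hk) :
    weight (liftedSpace k S ⊔ U₂) Q.submodule = 1 := by
  obtain ⟨u, hu, huU, rfl⟩ := hQ
  rw [weight_mk_eq_one_iff hu huU]
  intro l hl
  obtain ⟨x, ζ, hζ, w, hw, rfl⟩ := mem_liftedSpace_sup_iff.1 huU
  obtain ⟨y, η, hη, w', hw', h⟩ := mem_liftedSpace_sup_iff.1 hl
  rw [smul_add, smul_vec3,
    vec3_add_eq_vec3_add_iff hk (Submodule.smul_mem _ l (hU₂ hw)) (hU₂ hw')] at h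
  obtain ⟨-, h2, h3, h4⟩ := h
  by_cases hx : x = 0
  · by_cases hw0 : w = 0
    · refine absurd ?_ hne
      rw [firstPoint, Projectivization.mk_eq_mk_iff']
      exact ⟨ζ, by simp [smul_vec3, hx, hw0, Fintype.card_ne_zero]⟩
    · exact isScattered_iff.1 hsc w hw hw0 l (h4 ▸ hw')
  · apply exists_algebraMap_eq_of_pow_card_eq
    have hxq : x ^ Fintype.card K ^ 2 ≠ 0 := pow_ne_zero _ hx
    apply mul_right_cancel₀ hxq
    -- Raising `l x^q = y^q` to the power `q` and comparing with `l x^(q²) = y^(q²)` gives `l^q =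
    -- l`.
    rw [h3, pow_two, pow_mul, pow_mul, ← mul_pow, h2]

/-- A hyperplane that is the kernel of a functional with small image on `liftedSpace k S`
contains the subspace of all `(a, b, c, 0, …, 0)`. -/
theorem apply_vec3_eq_zero [Finite F] {S : Submodule K F} {U : Submodule K (Fin k → F)}
    (hU : liftedSpace k S ≤ U) {g : (Fin k → F) →ₗ[F] F}
    (hg : finrank K (U.map (g.restrictScalars K)) + 3 ≤ finrank K F) (a b c : F) :
    g (vec3 k a b c) = 0 := by
  let h : F →ₗ[K] F := g.restrictScalars K ∘ₗ liftedMap k S ∘ₗ LinearMap.inl K F S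
  have hdec (a b c : F) : g (vec3 k a b c) =
      g (vec3 k 1 0 0) * a + g (vec3 k 0 1 0) * b + g (vec3 k 0 0 1) * c := by
    have : vec3 k a b c = a • vec3 k 1 0 0 + b • vec3 k 0 1 0 + c • vec3 k 0 0 1 := by
      simp [smul_vec3, vec3_add_vec3]
    rw [this]
    simp only [map_add, map_smul, smul_eq_mul]
    ring
  have hh (x : F) : h x = g (vec3 k 1 0 0) * x + g (vec3 k 0 1 0) * x ^ Fintype.card K +
      g (vec3 k 0 0 1) * x ^ Fintype.card K ^ 2 := by
    rw [← hdec]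
    simp [h, liftedMap]
  have hrange : LinearMap.range h ≤ U.map (g.restrictScalars K) := by
    rintro _ ⟨x, rfl⟩
    refine ⟨liftedMap k S (x, 0), hU ?_, rfl⟩
    rw [← range_liftedMap]
    exact ⟨_, rfl⟩
  have hle := Submodule.finrank_mono hrange
  have hrn := LinearMap.finrank_range_add_finrank_ker h
  -- The image of `h` has dimension at most `m - 3`, so rank-nullity leaves a kernel of dimension at
  -- least 3.
  obtain ⟨h1, h2, h3⟩ := eq_zero_of_three_le_finrank_ker hh (by omega)
  rw [hdec, h1, h2, h3]
  ring

end Lifted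

/-! ### Hyperplane sections and the inequivalence -/

theorem finrank_map_add_finrank_inf_ker {K V V' : Type*} [Field K] [AddCommGroup V] [Module K V]
    [AddCommGroup V'] [Module K V'] [FiniteDimensional K V] (g : V →ₗ[K] V')
    (U : Submodule K V) :
    finrank K (U.map g) + finrank K ↥(U ⊓ LinearMap.ker g) = finrank K U := by
  have := LinearMap.finrank_range_add_finrank_ker (g.domRestrict U)
  rw [LinearMap.range_domRestrict, LinearMap.ker_domRestrict] at this
  rw [← this, ← Submodule.map_comap_subtype]
  congr 1
  exact LinearEquiv.finrank_eq (Submodule.equivMapOfInjective _ U.injective_subtype _).symm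

/-- If a projective subspace `PG(H, F)` meets `L_U` in as many points as a scattered linear set of
rank `n ≥ 2` has, then `H` meets `U` in dimension `n`, and `PG(H, F)` avoids the point of weight
`i` unless `i = 1`. -/
theorem finrank_inf_eq_of_ncard_eq {K F : Type*} [Field K] [Fintype K] [Field F] [Finite F] [Algebra K F]
    {k : ℕ} (hk : 3 ≤ k) {S : Submodule K F} (hS : 1 ≤ finrank K S)
    {U₂ : Submodule K (Fin k → F)} (hU₂ : U₂ ≤ (firstThreeZero F k).restrictScalars K)
    (hsc : IsScattered F U₂) {H : Submodule F (Fin k → F)} {n : ℕ} (hn : 2 ≤ n)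
    (hcard : Fintype.card K ^ n =
      1 + (linearSet F ((liftedSpace k S ⊔ U₂) ⊓ H.restrictScalars K)).ncard *
        (Fintype.card K - 1)) :
    finrank K ↥((liftedSpace k S ⊔ U₂) ⊓ H.restrictScalars K) = n ∧
      (finrank K S = 1 ∨ ¬ (firstPoint F hk).submodule ≤ H) := by
  set U := liftedSpace k S ⊔ U₂ with hU
  set q := Fintype.card K with hq
  have hq1 : 1 < q := Fintype.one_lt_card
  have hweight : ∀ Q ∈ linearSet F (U ⊓ H.restrictScalars K), Q ≠ firstPoint F hk →
      weight (U ⊓ H.restrictScalars K) Q.submodule = 1 := by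
    intro Q hQ hne
    rw [mem_linearSet_inf] at hQ
    rw [weight_inf_of_le hQ.2]
    exact weight_eq_one_of_ne_firstPoint hk hU₂ hsc hQ.1 hne
  by_cases hP : (firstPoint F hk).submodule ≤ H
  · have hmem : firstPoint F hk ∈ linearSet F (U ⊓ H.restrictScalars K) :=
      mem_linearSet_inf.2 ⟨firstPoint_mem_linearSet hk hS U₂, hP⟩
    have hcount := card_pow_finrank_eq_of_weight hmem hweight
    rw [← hcard, weight_inf_of_le hP, weight_firstPoint hk S hU₂] at hcount
    have hS1 : finrank K S = 1 := by
      by_contra hne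
      have hle : finrank K S ≤ finrank K ↥(U ⊓ H.restrictScalars K) := by
        rw [← weight_firstPoint hk S hU₂, ← weight_inf_of_le hP]
        exact Submodule.finrank_mono inf_le_left
      -- With `d = dim (U ∩ H)`, the count reads `q^d + q = q^n + q^i`. If `i ≥ 2`, then `d ≥ i ≥ 2`
      -- and every term except `q` is divisible by `q²`.
      have h1 : q ^ 2 ∣ q ^ n := pow_dvd_pow q hn
      have h2 : q ^ 2 ∣ q ^ finrank K S := pow_dvd_pow q (by omega)
      have h3 : q ^ 2 ∣ q ^ finrank K ↥(U ⊓ H.restrictScalars K) := pow_dvd_pow q (by omega)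
      have h4 : q ^ 2 ∣ q := (Nat.dvd_add_right h3).1 (hcount ▸ dvd_add h1 h2)
      have := Nat.le_of_dvd (by omega) h4
      nlinarith
    refine ⟨?_, Or.inl hS1⟩
    rw [hS1, pow_one] at hcount
    exact Nat.pow_right_injective hq1 (Nat.add_right_cancel hcount)
  · refine ⟨?_, Or.inr hP⟩
    have hscat : IsScattered F (U ⊓ H.restrictScalars K) := by
      intro Q hQ
      refine hweight Q hQ ?_
      rintro rfl
      exact hP (mem_linearSet_inf.1 hQ).2
    have hcount := hscat.card_pow_finrank_eq (F := F)
    rw [← hcard] at hcount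
    exact Nat.pow_right_injective hq1 hcount

theorem not_pointSetEquivalent_of_isConeConstruction {K F : Type*} [Field K] [Fintype K] [Field F]
    [Finite F] [Algebra K F] {k i : ℕ} (hk : 3 ≤ k) (hi : 1 ≤ i)
    (him : i + 3 ≤ finrank K F) {S : Submodule K F} (hS : finrank K S = i)
    {U₂ : Submodule K (Fin k → F)}
    (hU₂ : IsMaximumScatteredIn (firstThreeZero F k) U₂)
    {V : Submodule K (Fin k → F)} (hV : IsConeConstruction F i V) :
    ¬ PointSetEquivalent (linearSet F (liftedSpace k S ⊔ U₂)) (linearSet F V) := by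
  intro h
  obtain ⟨hU₂W, hsc, hrank⟩ := hU₂
  obtain ⟨g, n, hg0, hn, hcard⟩ := hV.exists_hyperplane_of_pointSetEquivalent h
  have h3 := finrank_firstThreeZero (F := F) hk
  rw [finrank_fin_fun] at hn
  have hn2 : 2 ≤ n := by nlinarith
  obtain ⟨hT, hor⟩ := finrank_inf_eq_of_ncard_eq hk (hS.symm ▸ hi) hU₂W hsc hn2 hcard
  have hsup := finrank_liftedSpace_sup hk S hU₂W
  have hker := finrank_map_add_finrank_inf_ker (g.restrictScalars K) (liftedSpace k S ⊔ U₂)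
  rw [LinearMap.ker_restrictScalars, hT, hsup, hS] at hker
  -- Since `2n = (k - 1)m`, the rank of `U` is `n + i`, and the kernel of `g` on `U` takes up
  -- exactly `n`.
  have hmap : finrank K ((liftedSpace k S ⊔ U₂).map (g.restrictScalars K)) = i := by
    have : (finrank F (firstThreeZero F k) + 3) * finrank K F = k * finrank K F := by rw [h3]
    rw [add_mul] at this
    omega
  have hzero := apply_vec3_eq_zero (g := g) (le_sup_left : liftedSpace k S ≤ liftedSpace k S ⊔ U₂)
    (by rw [hmap]; exact him)
  have hi1 : i = 1 := by
    rcases hor with h1 | h1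
    · rw [← hS, h1]
    · refine absurd ?_ h1
      simpa [firstPoint, Submodule.span_singleton_le_iff_mem] using hzero 1 0 0
  -- As `g` kills the first three coordinates and `g ≠ 0`, it cannot vanish on the complementary
  -- subspace.
  have hlt : finrank F ↥(firstThreeZero F k ⊓ LinearMap.ker g) <
      finrank F (firstThreeZero F k) := by
    refine Submodule.finrank_lt_finrank_of_lt (lt_of_le_of_ne inf_le_left fun heq => hg0 ?_)
    refine LinearMap.ext fun v => ?_
    obtain ⟨a, b, c, w, hw, rfl⟩ := exists_eq_vec3_add hk v
    rw [inf_eq_left] at heq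
    rw [map_add, hzero, heq hw]
    simp
  have hbound := (hsc.mono (U' := U₂ ⊓ (LinearMap.ker g).restrictScalars K)
    inf_le_left).two_mul_finrank_le (by omega)
    (W := firstThreeZero F k ⊓ LinearMap.ker g) (fun v hv => ⟨hU₂W hv.1, hv.2⟩)
  have hker₂ := finrank_map_add_finrank_inf_ker (g.restrictScalars K) U₂
  rw [LinearMap.ker_restrictScalars] at hker₂
  have hmap₂ : finrank K (U₂.map (g.restrictScalars K)) ≤ 1 := by
    rw [← hi1, ← hmap]
    exact Submodule.finrank_mono (Submodule.map_mono le_sup_right)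
  -- Losing one `F`-dimension lowers the scattered bound by `m/2`, so `m ≤ 2 dim g(U₂) ≤ 2`, against
  -- `m ≥ i + 3`.
  have hmul := Nat.mul_le_mul_right (finrank K F) (Nat.succ_le_of_lt hlt)
  rw [Nat.succ_mul] at hmul
  omega

end LinearSets

theorem mainTheorem7 {K F : Type*} [Field K] [Fintype K] [Field F] [Finite F] [Algebra K F]
    (k m i : ℕ) (hk : 6 ≤ k) (hkeven : Even k) (hmeven : Even m)
    (hm : Module.finrank K F = m) (hi : 1 ≤ i)
    (S : Submodule K F) (hS : Module.finrank K S = i)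
    (U₂ : Submodule K (Fin k → F))
    (hU₂ : LinearSets.IsMaximumScatteredIn (LinearSets.firstThreeZero F k) U₂) :
    (LinearSets.IsClub F i (LinearSets.liftedSpace k S ⊔ U₂) ∧
      Module.finrank K ↥(LinearSets.liftedSpace k S ⊔ U₂) = m * (k - 1) / 2 + i) ∧
    (i + 3 ≤ m → ∀ V : Submodule K (Fin k → F), LinearSets.IsConeConstruction F i V →
      ¬ LinearSets.PointSetEquivalent (LinearSets.linearSet F (LinearSets.liftedSpace k S ⊔ U₂))
          (LinearSets.linearSet F V) ∧
      ¬ LinearSets.SubspaceEquivalent F (LinearSets.liftedSpace k S ⊔ U₂) V) := by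
  have hk3 : 3 ≤ k := by omega
  refine ⟨⟨⟨LinearSets.firstPoint F hk3, ?_, ?_, ?_⟩, ?_⟩, ?_⟩
  · exact LinearSets.firstPoint_mem_linearSet hk3 (hS.symm ▸ hi) U₂
  · rw [LinearSets.weight_firstPoint hk3 S hU₂.1, hS]
  · intro Q hQ hne
    exact LinearSets.weight_eq_one_of_ne_firstPoint hk3 hU₂.1 hU₂.2.1 hQ hne
  · have h3 := LinearSets.finrank_firstThreeZero (F := F) hk3
    have hrank := hU₂.2.2
    rw [LinearSets.finrank_liftedSpace_sup hk3 S hU₂.1, hS]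
    have h1 : m * (k - 1) = 2 * (m + finrank K U₂) := by
      rw [mul_add, hrank, hm, show k - 1 = finrank F (LinearSets.firstThreeZero F k) + 2 by omega]
      ring
    rw [h1, Nat.mul_div_cancel_left _ (by norm_num), hm]
    omega
  · intro him V hV
    have hne := LinearSets.not_pointSetEquivalent_of_isConeConstruction hk3 hi
      (by rw [hm]; exact him) hS hU₂ hV
    -- A semilinear map carrying `U` onto `V` also carries `L_U` onto `L_V`, so the point-set
    -- statement is the stronger one.
    exact ⟨hne, fun h => hne h.pointSetEquivalent⟩
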